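/- For a real random variable $Y$, let $H_1(Y)$ be the set of functions $g:\mathbb{R}\to\mathbb{R}$ that are absolutely continuous on every compact interval, for which $g'(Y)$ exists almost surely, and which satisfy $0<\operatorname{Var} g(Y)\le\infty$ and $\mathbb{E}\,g'(Y)^2<\infty$. The Poincaré constant of $Y$ is $$R_Y=\sup_{g\in H_1(Y)}\frac{\operatorname{Var} g(Y)}{\mathbb{E}\,g'(Y)^2}\in[0,\infty],$$ where a ratio $v/0$ with $v>0$ counts as $\infty$. Theorem. Let $X_1,X_2,\ldots$ be IID real random variables with mean $0$, variance $\sigma^2$ (where $\sigma>0$) and finite Poincaré constant $R_{X_1}=R$. Put $U_n=(X_1+\cdots+X_n)/\sqrt{n\sigma^2}$ and let $Z$ be standard normal. Let $c<1/(12\sqrt{R})$ and let $w:\mathbb{R}\to\mathbb{R}$ be continuous with $|w(t)|\le\exp(c|t|)$ for all $t$. Then $w(Z)$ is integrable, $w(U_n)$ is integrable for all sufficiently large $n$, and $$\mathbb{E}\,w(U_n)\to\mathbb{E}\,w(Z)\qquad (n\to\infty).$$ -/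

import Mathlib

open MeasureTheory ProbabilityTheory Filter Topology
open scoped ENNReal NNReal

/-- `g : ℝ → ℝ` is absolutely continuous on the real line: it is absolutely continuous on
every compact interval. -/
def AbsContOnLine (g : ℝ → ℝ) : Prop :=
  ∀ a b : ℝ, AbsolutelyContinuousOnInterval g a b

/-- `E g'(Y)²` as an extended nonnegative number. -/
noncomputable def energy {Ω : Type*} [MeasurableSpace Ω] (P : Measure Ω) (Y : Ω → ℝ)
    (g : ℝ → ℝ) : ℝ≥0∞ :=
  ∫⁻ ω, ENNReal.ofReal ((deriv g (Y ω)) ^ 2) ∂P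

/-- The class `H₁(Y)`: absolutely continuous functions `g` on the real line such that
`Var g(Y) > 0` (the value `∞` is allowed) and `E g'(Y)² < ∞`. For `E g'(Y)²` to be meaningful,
the derivative `g'(Y)` has to exist almost surely. -/
structure MemH1 {Ω : Type*} [MeasurableSpace Ω] (P : Measure Ω) (Y : Ω → ℝ)
    (g : ℝ → ℝ) : Prop where
  absCont : AbsContOnLine g
  differentiable_ae : ∀ᵐ ω ∂P, DifferentiableAt ℝ g (Y ω)
  variance_pos : 0 < evariance (fun ω => g (Y ω)) P
  energy_lt_top : energy P Y g < ∞

/-- The Poincaré constant `R_Y = sup_{g ∈ H₁(Y)} Var g(Y) / E g'(Y)²`, an extended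
nonnegative number (a ratio `v / 0` with `v > 0` counts as `∞`). -/
noncomputable def poincareConst {Ω : Type*} [MeasurableSpace Ω] (P : Measure Ω)
    (Y : Ω → ℝ) : ℝ≥0∞ :=
  ⨆ (g : ℝ → ℝ) (_ : MemH1 P Y g), evariance (fun ω => g (Y ω)) P / energy P Y g

/-- The normalized partial sums `U_n = (X_1 + ⋯ + X_n) / √(n σ²)`; the sequence is indexed
from `0`, so these are the first `n` terms. -/
noncomputable def normalizedSum {Ω : Type*} (X : ℕ → Ω → ℝ) (σ : ℝ) (n : ℕ) (ω : Ω) : ℝ :=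
  (∑ i ∈ Finset.range n, X i ω) / √((n : ℝ) * σ ^ 2)

/-!
The finite Poincaré constant forces `X 0` to have exponential moments near the origin, and the
rest is the central limit theorem with uniform integrability.

Exponential moments. For `g = exp (a φ)` with `φ` smooth, bounded and `|φ'| ≤ 1`, the Poincaré
inequality reads `Var g(Y) ≤ R a² E g(Y)²`. If `R a² ≤ 1/10`, the variance is a small part of the
second moment, so `E g(Y)²` is of the order of `(E g(Y))²`; and a mean that dominates the standard
deviation is controlled by the values of `g` on the bulk `|Y| ≤ T` of the distribution
(`integral_sq_le_of_variance_le`). With `φ(x) = sin (ε x) / ε`, for which `|φ(x)| ≤ |x|`, this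
gives a bound on `E exp (2 a φ(Y))` that does not depend on `ε`, and Fatou's lemma as `ε → 0` gives
`E exp (2 a Y) < ∞` (`integrable_exp_mul_of_poincareConst_le`).

Convergence. As `X 0` is centred, `E exp (t X 0) ≤ exp (K t²)` for small `t`
(`exists_mgf_le_exp_sq`), and by independence `E exp (u U_n) ≤ exp (K u² / σ²)` as soon as
`|u| / √(n σ²)` is small (`eventually_mgf_normalizedSum_le`). Hence `E w(U_n)²` is bounded for large
`n`, which upgrades the weak convergence of `U_n` to the convergence of `E w(U_n)`
(`tendsto_integral_of_sq_integral_le`).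
-/

/-! ### Poincaré inequality and exponential moments -/

/-- The Poincaré inequality for `C¹` functions. If `g(Y)` has zero variance, `g` is not in `H₁(Y)`
and the inequality is trivial. -/
theorem evariance_le_mul_energy {Ω : Type*} [MeasurableSpace Ω] {P : Measure Ω} {Y : Ω → ℝ}
    {R : ℝ≥0} (hR : poincareConst P Y ≤ R) {g : ℝ → ℝ} (hg : ContDiff ℝ 1 g)
    (hE : energy P Y g < ∞) :
    evariance (fun ω => g (Y ω)) P ≤ R * energy P Y g := by
  rcases eq_or_ne (evariance (fun ω => g (Y ω)) P) 0 with h0 | h0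
  · simp [h0]
  have hmem : MemH1 P Y g :=
    { absCont := fun a b => hg.contDiffOn.absolutelyContinuousOnInterval
      differentiable_ae := ae_of_all _ fun ω => (hg.differentiable one_ne_zero) _
      variance_pos := pos_iff_ne_zero.2 h0
      energy_lt_top := hE }
  have h : evariance (fun ω => g (Y ω)) P / energy P Y g ≤ R :=
    (le_iSup₂ (f := fun (g : ℝ → ℝ) (_ : MemH1 P Y g) =>
      evariance (fun ω => g (Y ω)) P / energy P Y g) g hmem).trans hR
  exact (ENNReal.div_le_iff_le_mul (Or.inr ENNReal.coe_ne_top) (Or.inl hE.ne)).1 h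

theorem variance_le_of_abs_deriv_le {Ω : Type*} [MeasurableSpace Ω] {P : Measure Ω}
    [IsProbabilityMeasure P] {Y : Ω → ℝ} {R : ℝ≥0} (hR : poincareConst P Y ≤ R)
    {g : ℝ → ℝ} (hg : ContDiff ℝ 1 g) {a : ℝ} (hd : ∀ x, |deriv g x| ≤ |a| * |g x|)
    (hL : MemLp (fun ω => g (Y ω)) 2 P) :
    Var[fun ω => g (Y ω); P] ≤ R * a ^ 2 * ∫ ω, g (Y ω) ^ 2 ∂P := by
  have hint : Integrable (fun ω => a ^ 2 * g (Y ω) ^ 2) P := hL.integrable_sq.const_mul _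
  have hle : energy P Y g ≤ ENNReal.ofReal (a ^ 2 * ∫ ω, g (Y ω) ^ 2 ∂P) := by
    rw [← integral_const_mul,
      ofReal_integral_eq_lintegral_ofReal hint (ae_of_all _ fun ω => by positivity)]
    refine lintegral_mono fun ω => ENNReal.ofReal_le_ofReal ?_
    rw [← sq_abs, ← sq_abs a, ← sq_abs (g (Y ω)), ← mul_pow]
    exact pow_le_pow_left₀ (abs_nonneg _) (hd _) 2
  have h := (evariance_le_mul_energy hR hg (hle.trans_lt ENNReal.ofReal_lt_top)).trans
    (mul_le_mul_right hle (R : ℝ≥0∞))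
  have hS : 0 ≤ ∫ ω, g (Y ω) ^ 2 ∂P := integral_nonneg fun ω => sq_nonneg _
  rw [← ofReal_variance hL, ← ENNReal.ofReal_coe_nnreal, ← ENNReal.ofReal_mul R.coe_nonneg,
    ENNReal.ofReal_le_ofReal_iff (by positivity)] at h
  linarith

/-- A second moment bound for a function of `Y` whose variance is at most a tenth of its second
moment: the mean is then controlled by the values of the function on the bulk
`|Y| ≤ T` of the distribution. -/
theorem integral_sq_le_of_variance_le {Ω : Type*} [MeasurableSpace Ω] {P : Measure Ω}
    [IsProbabilityMeasure P] {Y G : Ω → ℝ} (hY : MemLp Y 2 P) (hG : MemLp G 2 P)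
    {T M : ℝ} (hT : 0 < T) (hYT : 4 * ∫ ω, Y ω ^ 2 ∂P ≤ T ^ 2)
    (hM : ∀ ω, |Y ω| ≤ T → |G ω| ≤ M)
    (hvar : Var[G; P] ≤ (1 / 10) * ∫ ω, G ω ^ 2 ∂P) :
    ∫ ω, G ω ^ 2 ∂P ≤ 16 * M ^ 2 := by
  set m := ∫ ω, G ω ∂P
  set S := ∫ ω, G ω ^ 2 ∂P
  have hV : Var[G; P] = S - m ^ 2 := variance_eq_sub hG
  have hV' : Var[G; P] = ∫ ω, (G ω - m) ^ 2 ∂P := variance_eq_integral hG.1.aemeasurable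
  have hY2 := hY.integrable_sq
  have hGm : Integrable (fun ω => (G ω - m) ^ 2) P := (hG.sub (memLp_const m)).integrable_sq
  -- A Chebyshev-type substitute for the indicator of `|Y| ≤ T`.
  have key : ∀ ω, m ^ 2 * (1 - Y ω ^ 2 / T ^ 2) ≤ 2 * M ^ 2 + 2 * (G ω - m) ^ 2 := by
    intro ω
    rcases le_total (|Y ω|) T with h | h
    · have h1 : G ω ^ 2 ≤ M ^ 2 := sq_le_sq' (by linarith [abs_le.1 (hM ω h)])
        (abs_le.1 (hM ω h)).2
      have h2 : m ^ 2 * (1 - Y ω ^ 2 / T ^ 2) ≤ m ^ 2 :=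
        mul_le_of_le_one_right (sq_nonneg _) (by linarith [show 0 ≤ Y ω ^ 2 / T ^ 2 by positivity])
      nlinarith [sq_nonneg (2 * G ω - m)]
    · have h1 : 1 ≤ Y ω ^ 2 / T ^ 2 := by
        rw [one_le_div (by positivity), ← sq_abs (Y ω)]
        exact pow_le_pow_left₀ hT.le h 2
      have h2 : m ^ 2 * (1 - Y ω ^ 2 / T ^ 2) ≤ 0 :=
        mul_nonpos_of_nonneg_of_nonpos (sq_nonneg _) (by linarith)
      exact h2.trans (by positivity)
  have hi := integral_mono (μ := P)
    (((integrable_const (1 : ℝ)).sub (hY2.div_const (T ^ 2))).const_mul (m ^ 2))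
    ((integrable_const (2 * M ^ 2)).add (hGm.const_mul 2)) key
  simp only [Pi.add_apply, Pi.sub_apply] at hi
  rw [integral_const_mul, integral_sub (integrable_const _) (hY2.div_const _), integral_div,
    integral_add (integrable_const _) (hGm.const_mul 2),
    integral_const_mul 2 (fun ω => (G ω - m) ^ 2), ← hV'] at hi
  simp only [integral_const, probReal_univ, smul_eq_mul, one_mul] at hi
  have hq : (∫ ω, Y ω ^ 2 ∂P) / T ^ 2 ≤ 1 / 4 := by
    rw [div_le_div_iff₀ (by positivity) (by norm_num)]
    linarith
  have := mul_le_mul_of_nonneg_left hq (sq_nonneg m)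
  nlinarith

/-- The smooth bounded truncation `x ↦ sin (ε x) / ε` is dominated by `|x|`. -/
theorem abs_sin_mul_div_le {ε : ℝ} (hε : 0 < ε) (x : ℝ) : |Real.sin (ε * x) / ε| ≤ |x| := by
  rw [abs_div, abs_of_pos hε, div_le_iff₀ hε]
  calc |Real.sin (ε * x)| ≤ |ε * x| := Real.abs_sin_le_abs
    _ = |x| * ε := by rw [abs_mul, abs_of_pos hε, mul_comm]

theorem tendsto_sin_mul_div (x : ℝ) :
    Tendsto (fun ε : ℝ => Real.sin (ε * x) / ε) (𝓝[≠] 0) (𝓝 x) := by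
  have h : HasDerivAt (fun ε : ℝ => Real.sin (ε * x)) x 0 := by
    simpa using ((hasDerivAt_id (0 : ℝ)).mul_const x).sin
  refine h.tendsto_slope_zero.congr fun ε => ?_
  simp [div_eq_inv_mul]

/-- Exponential moments of the truncations `sin (ε Y) / ε`, bounded uniformly in `ε`. -/
theorem exists_integral_exp_truncation_le {Ω : Type*} [MeasurableSpace Ω] {P : Measure Ω}
    [IsProbabilityMeasure P] {Y : Ω → ℝ} (hY : MemLp Y 2 P) {R : ℝ≥0}
    (hR : poincareConst P Y ≤ R) {a : ℝ} (ha : R * a ^ 2 ≤ 1 / 10) :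
    ∃ C : ℝ, ∀ ε : ℝ, 0 < ε →
      Integrable (fun ω => Real.exp (2 * a * (Real.sin (ε * Y ω) / ε))) P ∧
      ∫ ω, Real.exp (2 * a * (Real.sin (ε * Y ω) / ε)) ∂P ≤ C := by
  -- The summand `1` keeps `T` positive when `Y` vanishes almost surely.
  set T : ℝ := √(4 * ∫ ω, Y ω ^ 2 ∂P + 1)
  have hs : 0 ≤ ∫ ω, Y ω ^ 2 ∂P := integral_nonneg fun ω => sq_nonneg _
  have hT : 0 < T := Real.sqrt_pos.2 (by linarith)
  have hT2 : T ^ 2 = 4 * ∫ ω, Y ω ^ 2 ∂P + 1 := Real.sq_sqrt (by linarith)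
  refine ⟨16 * Real.exp (|a| * T) ^ 2, fun ε hε => ?_⟩
  set g : ℝ → ℝ := fun x => Real.exp (a * (Real.sin (ε * x) / ε)) with hgdef
  have hg : ContDiff ℝ 1 g := by fun_prop
  have hd : ∀ x, |deriv g x| ≤ |a| * |g x| := by
    intro x
    have h : HasDerivAt g (g x * (a * Real.cos (ε * x))) x := by
      have h1 := (((((hasDerivAt_id x).const_mul ε).sin).div_const ε).const_mul a).exp
      convert! h1 using 1
      simp only [hgdef, id]
      field_simp
    rw [h.deriv, abs_mul, abs_mul, mul_comm]
    exact mul_le_mul_of_nonneg_right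
      (mul_le_of_le_one_right (abs_nonneg _) (Real.abs_cos_le_one _)) (abs_nonneg _)
  have hgm : AEStronglyMeasurable (fun ω => g (Y ω)) P :=
    hg.continuous.comp_aestronglyMeasurable hY.1
  have hL : MemLp (fun ω => g (Y ω)) 2 P := by
    refine MemLp.of_bound hgm (Real.exp (|a| * (1 / ε))) (ae_of_all _ fun ω => ?_)
    rw [Real.norm_eq_abs, Real.abs_exp, Real.exp_le_exp]
    refine (le_abs_self _).trans ?_
    rw [abs_mul, abs_div, abs_of_pos hε]
    gcongr
    exact Real.abs_sin_le_one _
  have hsq : ∀ ω, g (Y ω) ^ 2 = Real.exp (2 * a * (Real.sin (ε * Y ω) / ε)) := by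
    intro ω
    rw [hgdef, ← Real.exp_nat_mul]
    congr 1
    push_cast
    ring
  have hvar := variance_le_of_abs_deriv_le hR hg hd hL
  have h := integral_sq_le_of_variance_le (M := Real.exp (|a| * T)) hY hL hT (by linarith)
    (fun ω hω => by
      rw [Real.abs_exp, Real.exp_le_exp]
      refine (le_abs_self _).trans ?_
      rw [abs_mul]
      gcongr
      exact (abs_sin_mul_div_le hε _).trans hω)
    (hvar.trans (mul_le_mul_of_nonneg_right ha (integral_nonneg fun ω => sq_nonneg _)))
  have hi := hL.integrable_sq
  simp only [hsq] at h hi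
  exact ⟨hi, h⟩

theorem integrable_exp_mul_of_poincareConst_le {Ω : Type*} [MeasurableSpace Ω] {P : Measure Ω}
    [IsProbabilityMeasure P] {Y : Ω → ℝ} (hY : MemLp Y 2 P) {R : ℝ≥0}
    (hR : poincareConst P Y ≤ R) {a : ℝ} (ha : R * a ^ 2 ≤ 1 / 10) :
    Integrable (fun ω => Real.exp (2 * a * Y ω)) P := by
  obtain ⟨C, hC⟩ := exists_integral_exp_truncation_le hY hR ha
  set f : ℕ → Ω → ℝ := fun k ω =>
    Real.exp (2 * a * (Real.sin (1 / ((k : ℝ) + 1) * Y ω) / (1 / ((k : ℝ) + 1)))) with hf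
  have hk : ∀ k : ℕ, (0 : ℝ) < 1 / ((k : ℝ) + 1) := fun k => Nat.one_div_pos_of_nat
  have hlim : ∀ ω, Tendsto (fun k => f k ω) atTop (𝓝 (Real.exp (2 * a * Y ω))) := by
    intro ω
    have h0 : Tendsto (fun k : ℕ => 1 / ((k : ℝ) + 1)) atTop (𝓝[≠] 0) :=
      tendsto_nhdsWithin_iff.2 ⟨tendsto_one_div_add_atTop_nhds_zero_nat,
        Eventually.of_forall fun k => (hk k).ne'⟩
    exact (Real.continuous_exp.tendsto _).comp
      (((tendsto_sin_mul_div (Y ω)).comp h0).const_mul (2 * a))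
  have hbd : ∀ k, ∫⁻ ω, ‖f k ω‖ₑ ∂P ≤ ENNReal.ofReal C := by
    intro k
    have h := hC _ (hk k)
    have h1 : ∀ ω, ‖f k ω‖ₑ = ENNReal.ofReal (f k ω) := fun ω =>
      Real.enorm_eq_ofReal (Real.exp_pos _).le
    simp only [h1]
    rw [← ofReal_integral_eq_lintegral_ofReal h.1 (ae_of_all _ fun ω => (Real.exp_pos _).le)]
    exact ENNReal.ofReal_le_ofReal h.2
  refine ⟨(hY.1.const_mul _).aemeasurable.exp.aestronglyMeasurable, ?_⟩
  calc ∫⁻ ω, ‖Real.exp (2 * a * Y ω)‖ₑ ∂P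
      = ∫⁻ ω, liminf (fun k => ‖f k ω‖ₑ) atTop ∂P :=
        lintegral_congr fun ω => ((continuous_enorm.tendsto _).comp (hlim ω)).liminf_eq.symm
    _ ≤ liminf (fun k => ∫⁻ ω, ‖f k ω‖ₑ ∂P) atTop :=
        lintegral_liminf_le' fun k => (hC _ (hk k)).1.1.enorm
    _ ≤ ENNReal.ofReal C := liminf_le_of_le (by isBoundedDefault) fun b hb => by
        obtain ⟨k, hk⟩ := hb.exists
        exact hk.trans (hbd k)
    _ < ∞ := ENNReal.ofReal_lt_top

/-! ### Moment generating functions of the normalized sums -/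

theorem exp_le_one_add_add_sq_mul_exp_abs (x : ℝ) :
    Real.exp x ≤ 1 + x + x ^ 2 * Real.exp |x| := by
  have h := Complex.norm_exp_sub_sum_le_norm_mul_exp (x : ℂ) 2
  have h2 : Complex.exp x - ∑ m ∈ Finset.range 2, (x : ℂ) ^ m / (m.factorial : ℂ)
      = ((Real.exp x - (1 + x) : ℝ) : ℂ) := by
    simp [Finset.sum_range_succ]
  rw [h2, Complex.norm_real, Complex.norm_real, Real.norm_eq_abs, Real.norm_eq_abs, sq_abs] at h
  linarith [le_abs_self (Real.exp x - (1 + x))]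

/-- A centred random variable with exponential moments has a sub-Gaussian moment generating
function near the origin. -/
theorem exists_mgf_le_exp_sq {Ω : Type*} [MeasurableSpace Ω] {P : Measure Ω}
    [IsProbabilityMeasure P] {Y : Ω → ℝ} (hY : Integrable Y P) (hmean : P[Y] = 0) {s : ℝ}
    (hs : 0 < s) (hpos : Integrable (fun ω => Real.exp (2 * s * Y ω)) P)
    (hneg : Integrable (fun ω => Real.exp (2 * -s * Y ω)) P) :
    ∃ K : ℝ, ∀ t, |t| ≤ s →
      Integrable (fun ω => Real.exp (t * Y ω)) P ∧ mgf Y P t ≤ Real.exp (K * t ^ 2) := by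
  have hK := integrable_pow_abs_mul_exp_add_of_integrable_exp_mul (X := Y) (μ := P) (v := 0)
    (t := 2 * s) (x := s) (by simpa using hpos) (by simpa using hneg) hs.le
    (by rw [abs_of_pos (by positivity)]; linarith) 2
  simp only [sq_abs, zero_mul, zero_add] at hK
  refine ⟨∫ ω, Y ω ^ 2 * Real.exp (s * |Y ω|) ∂P, fun t ht => ?_⟩
  have ht' := abs_le.1 ht
  have hit : Integrable (fun ω => Real.exp (t * Y ω)) P :=
    integrable_exp_mul_of_le_of_le (a := 2 * -s) (b := 2 * s) hneg hpos
      (by linarith) (by linarith)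
  refine ⟨hit, ?_⟩
  have hpt : ∀ ω, Real.exp (t * Y ω) ≤
      1 + t * Y ω + t ^ 2 * (Y ω ^ 2 * Real.exp (s * |Y ω|)) := by
    intro ω
    refine (exp_le_one_add_add_sq_mul_exp_abs _).trans ?_
    rw [mul_pow, mul_assoc, abs_mul]
    gcongr
  have hi := integral_mono hit
    (((integrable_const 1).add (hY.const_mul t)).add (hK.const_mul (t ^ 2))) hpt
  have hadd := integral_add ((integrable_const (μ := P) (1 : ℝ)).add (hY.const_mul t))
    (hK.const_mul (t ^ 2))
  simp only [Pi.add_apply] at hi hadd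
  rw [hadd, integral_add (integrable_const 1) (hY.const_mul t), integral_const_mul,
    integral_const_mul, hmean] at hi
  simp only [integral_const, probReal_univ, smul_eq_mul] at hi
  have := Real.add_one_le_exp ((∫ ω, Y ω ^ 2 * Real.exp (s * |Y ω|) ∂P) * t ^ 2)
  rw [mgf]
  linarith

theorem eventually_mgf_normalizedSum_le {Ω : Type*} [MeasurableSpace Ω] {P : Measure Ω}
    [IsProbabilityMeasure P] {X : ℕ → Ω → ℝ} (hindep : iIndepFun X P)
    (hident : ∀ i, IdentDistrib (X i) (X 0) P P) {σ : ℝ} (hσ : 0 < σ) {s K : ℝ} (hs : 0 < s)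
    (hK : ∀ t, |t| ≤ s →
      Integrable (fun ω => Real.exp (t * X 0 ω)) P ∧ mgf (X 0) P t ≤ Real.exp (K * t ^ 2))
    (u : ℝ) :
    ∀ᶠ n : ℕ in atTop, Integrable (fun ω => Real.exp (u * normalizedSum X σ n ω)) P ∧
      mgf (normalizedSum X σ n) P u ≤ Real.exp (K * (u ^ 2 / σ ^ 2)) := by
  have hlim : Tendsto (fun n : ℕ => √((n : ℝ) * σ ^ 2)) atTop atTop :=
    Real.tendsto_sqrt_atTop.comp (tendsto_natCast_atTop_atTop.atTop_mul_const (by positivity))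
  filter_upwards [hlim.eventually_ge_atTop (|u| / s), eventually_gt_atTop 0] with n hn hn0
  have hn0' : (0 : ℝ) < n := Nat.cast_pos.2 hn0
  have hr : 0 < √((n : ℝ) * σ ^ 2) := Real.sqrt_pos.2 (by positivity)
  have hr2 : √((n : ℝ) * σ ^ 2) ^ 2 = n * σ ^ 2 := Real.sq_sqrt (by positivity)
  set r := √((n : ℝ) * σ ^ 2) with hrdef
  obtain ⟨hint, hle⟩ := hK (u / r) (by
    rw [abs_div, abs_of_pos hr, div_le_iff₀ hr, mul_comm]
    exact (div_le_iff₀ hs).1 hn)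
  have hmgf : mgf (normalizedSum X σ n) P u = mgf (X 0) P (u / r) ^ n := by
    have h := mgf_sum_of_identDistrib₀ (s := Finset.range n) (j := 0)
      (fun i => (hident i).aemeasurable_fst) hindep
      (fun i _ j _ => (hident i).trans (hident j).symm) (Finset.mem_range.2 hn0) (u / r)
    rw [Finset.card_range] at h
    rw [← h]
    simp only [mgf, normalizedSum, Finset.sum_apply]
    refine integral_congr_ae (ae_of_all _ fun ω => ?_)
    simp only [← hrdef]
    congr 1
    ring
  refine ⟨mgf_pos_iff.1 (hmgf ▸ pow_pos (mgf_pos hint) n), ?_⟩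
  rw [hmgf]
  refine (pow_le_pow_left₀ mgf_nonneg hle n).trans_eq ?_
  rw [← Real.exp_nat_mul, div_pow, hr2]
  congr 1
  field_simp

/-! ### From weak convergence to convergence of expectations -/

/-- Weak convergence together with bounded second moments of `w` gives convergence of the
expectations of the continuous, possibly unbounded, function `w`. -/
theorem tendsto_integral_of_sq_integral_le {μ : ℕ → Measure ℝ} {ν : Measure ℝ}
    [∀ n, IsProbabilityMeasure (μ n)] [IsProbabilityMeasure ν] {w : ℝ → ℝ} (hw : Continuous w)
    (hweak : ∀ f : BoundedContinuousFunction ℝ ℝ,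
      Tendsto (fun n => ∫ x, f x ∂(μ n)) atTop (𝓝 (∫ x, f x ∂ν)))
    {C : ℝ} (hμ : ∀ᶠ n in atTop, MemLp w 2 (μ n) ∧ ∫ x, w x ^ 2 ∂(μ n) ≤ C)
    (hν : MemLp w 2 ν) (hνC : ∫ x, w x ^ 2 ∂ν ≤ C) :
    Tendsto (fun n => ∫ x, w x ∂(μ n)) atTop (𝓝 (∫ x, w x ∂ν)) := by
  have hC : 0 ≤ C := (integral_nonneg fun x => sq_nonneg _).trans hνC
  -- Clipping `w` at height `M` changes it by at most `w ^ 2 / M`.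
  have hclip : ∀ M : ℝ, 0 < M → ∀ y : ℝ, |y - max (-M) (min M y)| ≤ y ^ 2 / M := by
    intro M hM y
    rw [le_div_iff₀ hM]
    rcases le_total M y with h | h
    · rw [min_eq_left h, max_eq_right (by linarith), abs_of_nonneg (by linarith)]
      nlinarith
    · rw [min_eq_right h]
      rcases le_total (-M) y with h' | h'
      · rw [max_eq_right h', sub_self, abs_zero, zero_mul]
        positivity
      · rw [max_eq_left h', abs_of_nonpos (by linarith)]
        nlinarith
  have hclip_le : ∀ M : ℝ, 0 < M → ∀ y : ℝ, |max (-M) (min M y)| ≤ M := fun M hM y =>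
    abs_le.2 ⟨le_max_left _ _, max_le (by linarith) (min_le_left _ _)⟩
  have hdiff : ∀ M : ℝ, 0 < M → ∀ (ρ : Measure ℝ) [IsProbabilityMeasure ρ], MemLp w 2 ρ →
      ∫ x, w x ^ 2 ∂ρ ≤ C →
      |∫ x, w x ∂ρ - ∫ x, max (-M) (min M (w x)) ∂ρ| ≤ C / M := by
    intro M hM ρ _ hρ hρC
    have hi : Integrable w ρ := hρ.integrable one_le_two
    have hi' : Integrable (fun x => max (-M) (min M (w x))) ρ :=
      Integrable.of_bound (by fun_prop) M (ae_of_all _ fun x => hclip_le M hM _)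
    rw [← integral_sub hi hi']
    refine (abs_integral_le_integral_abs).trans ?_
    refine (integral_mono (hi.sub hi').abs (hρ.integrable_sq.div_const M)
      fun x => hclip M hM (w x)).trans ?_
    rw [integral_div]
    gcongr
  rw [Metric.tendsto_nhds]
  intro ε hε
  obtain ⟨M, hM, hMε⟩ : ∃ M : ℝ, 0 < M ∧ C / M < ε / 3 := by
    refine ⟨3 * (C + 1) / ε, by positivity, ?_⟩
    rw [div_lt_iff₀ (by positivity)]
    field_simp
    linarith
  have hf := hweak (BoundedContinuousFunction.ofNormedAddCommGroup
    (fun x => max (-M) (min M (w x))) (by fun_prop) M fun x => hclip_le M hM _)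
  simp only [BoundedContinuousFunction.coe_ofNormedAddCommGroup] at hf
  filter_upwards [hμ, Metric.tendsto_nhds.1 hf (ε / 3) (by positivity)] with n hn hfn
  have h1 := hdiff M hM (μ n) hn.1 hn.2
  have h2 := hdiff M hM ν hν hνC
  rw [Real.dist_eq] at hfn ⊢
  rw [abs_le] at h1 h2
  rw [abs_lt] at hfn ⊢
  constructor <;> linarith

theorem memLp_two_of_abs_le_exp {Ω : Type*} [MeasurableSpace Ω] {P : Measure Ω}
    {U W : Ω → ℝ} (hW : AEStronglyMeasurable W P) {d : ℝ}
    (hle : ∀ ω, |W ω| ≤ Real.exp (d * |U ω|))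
    (hpos : Integrable (fun ω => Real.exp (2 * d * U ω)) P)
    (hneg : Integrable (fun ω => Real.exp (-(2 * d) * U ω)) P) :
    MemLp W 2 P ∧ ∫ ω, W ω ^ 2 ∂P ≤ mgf U P (2 * d) + mgf U P (-(2 * d)) := by
  have hsq : ∀ ω, W ω ^ 2 ≤ Real.exp (2 * d * U ω) + Real.exp (-(2 * d) * U ω) := by
    intro ω
    have h1 : W ω ^ 2 ≤ Real.exp (2 * d * |U ω|) := by
      rw [← sq_abs]
      refine (pow_le_pow_left₀ (abs_nonneg _) (hle ω) 2).trans_eq ?_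
      rw [← Real.exp_nat_mul]
      congr 1
      push_cast
      ring
    refine h1.trans ?_
    have e1 := Real.exp_pos (2 * d * U ω)
    have e2 := Real.exp_pos (-(2 * d) * U ω)
    rcases abs_cases (U ω) with h | h
    · rw [h.1]
      linarith
    · rw [h.1, mul_neg, ← neg_mul]
      linarith
  have hi : Integrable (fun ω => W ω ^ 2) P :=
    (hpos.add hneg).mono' (hW.pow 2) (ae_of_all _ fun ω => by
      rw [Real.norm_eq_abs, abs_of_nonneg (sq_nonneg _)]
      exact hsq ω)
  refine ⟨(memLp_two_iff_integrable_sq hW).2 hi, ?_⟩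
  rw [mgf, mgf, ← integral_add hpos hneg]
  exact integral_mono hi (hpos.add hneg) hsq

theorem tendstoInDistribution_normalizedSum {Ω : Type*} [MeasurableSpace Ω] {P : Measure Ω}
    [IsProbabilityMeasure P] {X : ℕ → Ω → ℝ} (hindep : iIndepFun X P)
    (hident : ∀ i, IdentDistrib (X i) (X 0) P P) (hL2 : MemLp (X 0) 2 P) (hmean : P[X 0] = 0)
    {σ : ℝ} (hσ : 0 < σ) (hvar : Var[X 0; P] = σ ^ 2) :
    TendstoInDistribution (normalizedSum X σ) atTop id (fun _ => P) (gaussianReal 0 1) := by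
  have h := tendstoInDistribution_inv_sqrt_mul_sum (P := P) (X := fun i ω => X i ω / σ) (Y := id)
    (P' := gaussianReal 0 1) HasLaw.id
    (by rw [integral_div, hmean, zero_div])
    (by
      simp only [Pi.pow_apply, div_pow]
      rw [integral_div, ← variance_of_integral_eq_zero hL2.1.aemeasurable hmean, hvar,
        div_self (by positivity)])
    (hindep.comp (fun _ x => x / σ) (by fun_prop))
    (fun i => (hident i).comp (u := fun x => x / σ) (by fun_prop))
  convert! h using 2 with n
  funext ω
  rw [normalizedSum, Real.sqrt_mul (Nat.cast_nonneg _), Real.sqrt_sq hσ.le, ← Finset.sum_div]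
  field_simp

theorem theorem1p7 {Ω : Type*} [MeasurableSpace Ω] (P : Measure Ω) [IsProbabilityMeasure P]
    (X : ℕ → Ω → ℝ)
    (hindep : iIndepFun X P) (hident : ∀ i, IdentDistrib (X i) (X 0) P P)
    (hL2 : MemLp (X 0) 2 P) (hmean : P[X 0] = 0)
    (σ : ℝ) (hσ : 0 < σ) (hvar : Var[X 0; P] = σ ^ 2)
    (R : ℝ≥0) (hR : poincareConst P (X 0) = R)
    (c : ℝ) (hc : c < 1 / (12 * √(R : ℝ)))
    (w : ℝ → ℝ) (hw : Continuous w) (hbound : ∀ t, |w t| ≤ Real.exp (c * |t|)) :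
    Integrable w (gaussianReal 0 1) ∧
      (∀ᶠ n : ℕ in atTop, Integrable (fun ω => w (normalizedSum X σ n ω)) P) ∧
      Tendsto (fun n : ℕ => ∫ ω, w (normalizedSum X σ n ω) ∂P) atTop
        (𝓝 (∫ z, w z ∂(gaussianReal 0 1))) := by
  obtain ⟨s, hs, hsR⟩ : ∃ s : ℝ, 0 < s ∧ R * s ^ 2 ≤ 1 / 10 := by
    have hR0 : (0 : ℝ) ≤ R := R.coe_nonneg
    refine ⟨√(1 / (10 * (R + 1))), Real.sqrt_pos.2 (by positivity), ?_⟩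
    rw [Real.sq_sqrt (by positivity), mul_one_div, div_le_div_iff₀ (by positivity) (by norm_num)]
    linarith
  obtain ⟨K, hK⟩ := exists_mgf_le_exp_sq (hL2.integrable one_le_two) hmean hs
    (integrable_exp_mul_of_poincareConst_le hL2 hR.le hsR)
    (integrable_exp_mul_of_poincareConst_le hL2 hR.le (a := -s) (by rwa [neg_sq]))
  have hclt := tendstoInDistribution_normalizedSum hindep hident hL2 hmean hσ hvar
  have hU := hclt.forall_aemeasurable
  have hZ := memLp_two_of_abs_le_exp (P := gaussianReal 0 1) (U := id)
    hw.aestronglyMeasurable hbound (integrable_exp_mul_gaussianReal _)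
    (integrable_exp_mul_gaussianReal _)
  set A := Real.exp (K * ((2 * c) ^ 2 / σ ^ 2)) + Real.exp (K * ((-(2 * c)) ^ 2 / σ ^ 2))
  have hUn : ∀ᶠ n : ℕ in atTop, MemLp (fun ω => w (normalizedSum X σ n ω)) 2 P ∧
      ∫ ω, w (normalizedSum X σ n ω) ^ 2 ∂P ≤ A := by
    filter_upwards [eventually_mgf_normalizedSum_le hindep hident hσ hs hK (2 * c),
      eventually_mgf_normalizedSum_le hindep hident hσ hs hK (-(2 * c))] with n h1 h2
    have h := memLp_two_of_abs_le_exp (W := fun ω => w (normalizedSum X σ n ω))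
      (hw.comp_aestronglyMeasurable (hU n).aestronglyMeasurable) (fun ω => hbound _) h1.1 h2.1
    exact ⟨h.1, h.2.trans (add_le_add h1.2 h2.2)⟩
  refine ⟨hZ.1.integrable one_le_two, hUn.mono fun n hn => hn.1.integrable one_le_two, ?_⟩
  have hmap : ∀ n, IsProbabilityMeasure (P.map (normalizedSum X σ n)) := fun n =>
    Measure.isProbabilityMeasure_map (hU n)
  have hweak := ProbabilityMeasure.tendsto_iff_forall_integral_tendsto.1 hclt.tendsto
  simp only [ProbabilityMeasure.coe_mk, Measure.map_id] at hweak
  have h := tendsto_integral_of_sq_integral_le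
    (C := max A (∫ z, w z ^ 2 ∂(gaussianReal 0 1))) hw hweak ?_ hZ.1 (le_max_right _ _)
  · refine h.congr fun n => ?_
    rw [integral_map (hU n) hw.aestronglyMeasurable]
  · filter_upwards [hUn] with n hn
    rw [memLp_map_measure_iff hw.aestronglyMeasurable (hU n),
      integral_map (hU n) (by fun_prop)]
    exact ⟨hn.1, hn.2.trans (le_max_left _ _)⟩
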